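/- A quandle is a set $X$ with a binary operation $\lhd$ such that $x\lhd x=x$, each map $(\bullet\lhd y):X\to X$ is bijective, and $(x\lhd y)\lhd z=(x\lhd z)\lhd(y\lhd z)$. Its adjoint group is $$\mathrm{As}(X)=\langle\, e_x\ (x\in X)\ \mid\ e_{x\lhd y}^{-1}e_y^{-1}e_xe_y\ (x,y\in X)\,\rangle ,$$ which acts on $X$ from the right by $x\cdot e_y=x\lhd y$; $X$ is connected if this action has exactly one orbit. A quandle homomorphism $f:Y\to X$ induces the homomorphism $f_*:\mathrm{As}(Y)\to\mathrm{As}(X)$, $e_y\mapsto e_{f(y)}$. The quandle $X$ is of finite type $t_X$ (written $t_X<\infty$) if $t_X$ is the least integer $N>0$ such that $x\lhd^N y=x$ for all $x,y\in X$, where $\bullet\lhd^N y$ is the $N$-fold application of $\bullet\lhd y$. The quandle homology $H^Q_n(X)$ is the homology of $C^R_n(X)/C^D_n(X)$, where $C^R_n(X)$ is the free $\mathbb Z$-module on $X^n$ with boundary $$\partial_n(x_1,\dots,x_n)=\sum_{i=1}^n(-1)^i\bigl((x_1\lhd x_i,\dots,x_{i-1}\lhd x_i,x_{i+1},\dots,x_n)-(x_1,\dots,x_{i-1},x_{i+1},\dots,x_n)\bigr),$$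 and $C^D_n(X)$ is the subcomplex generated by the tuples with $x_i=x_{i+1}$ for some $i$. Let $X$ be a connected quandle, let $a\in X$, and let $\varepsilon:\mathrm{As}(X)\to\mathbb Z$ be the homomorphism with $\varepsilon(e_x)=1$ for all $x\in X$. The universal covering of $X$ is the map $p:\widetilde X\to X$, where $\widetilde X$ is the set $\mathrm{Ker}(\varepsilon)$ with the quandle operation $g\lhd h=e_a^{-1}gh^{-1}e_ah$, and $p(g)=a\cdot g$. **Theorem.** There is a group isomorphism $$H_2^Q(\widetilde X)\;\cong\;\mathrm{Ker}\bigl(p_*:\mathrm{As}(\widetilde X)\to\mathrm{As}(X)\bigr).$$ In particular, if $t_X<\infty$, then $H_2^Q(\widetilde X)$ is annihilated by $t_X$. -/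

import Mathlib

namespace NosakaQuandle

universe u v

/-- The quandle operation written on the right, `x ⊲ y`. Mathlib's quandles act from the left:
`x ⊲ y` is Mathlib's `Shelf.act y x`, so that `(• ⊲ y)` is bijective, `x ⊲ x = x` and
`(x ⊲ y) ⊲ z = (x ⊲ z) ⊲ (y ⊲ z)`. -/
def rop {X : Type u} [Shelf X] (x y : X) : X := Shelf.act y x

infixl:70 " ⊲ " => rop

theorem rop_self {X : Type u} [Quandle X] (x : X) : x ⊲ x = x := Quandle.fix

theorem rop_distrib {X : Type u} [Shelf X] (x y z : X) :
    (x ⊲ y) ⊲ z = (x ⊲ z) ⊲ (y ⊲ z) := Shelf.self_distrib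

/-! ### The adjoint group -/

/-- The relators `e_{x ⊲ y}⁻¹ e_y⁻¹ e_x e_y` of the adjoint group. -/
def asRels (X : Type u) [Quandle X] : Set (FreeGroup X) :=
  {r | ∃ x y : X, r = (FreeGroup.of (x ⊲ y))⁻¹ * (FreeGroup.of y)⁻¹ * FreeGroup.of x *
    FreeGroup.of y}

/-- The adjoint group `As(X) = ⟨ e_x (x ∈ X) | e_{x ⊲ y}⁻¹ e_y⁻¹ e_x e_y (x, y ∈ X) ⟩`.
(Mathlib's `Rack.EnvelGroup X` has the relations `e_{x ⊲ y} = e_y e_x e_y⁻¹`, that is, it is the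
opposite group.) -/
abbrev As (X : Type u) [Quandle X] : Type u := PresentedGroup (asRels X)

/-- The generator `e_x` of `As(X)`. -/
def e {X : Type u} [Quandle X] (x : X) : As X := PresentedGroup.of x

theorem e_rop {X : Type u} [Quandle X] (x y : X) : e (x ⊲ y) = (e y)⁻¹ * e x * e y := by
  have h : PresentedGroup.mk (asRels X) ((FreeGroup.of (x ⊲ y))⁻¹ * (FreeGroup.of y)⁻¹ *
      FreeGroup.of x * FreeGroup.of y) = 1 :=
    PresentedGroup.one_of_mem ⟨x, y, rfl⟩
  simp only [map_mul, map_inv] at h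
  change (e (x ⊲ y))⁻¹ * (e y)⁻¹ * e x * e y = 1 at h
  rw [mul_assoc, mul_assoc, inv_mul_eq_one] at h
  rw [h, mul_assoc]

/-- The homomorphism `As(X) → G` sending `e_x` to `f x`. -/
def As.lift {X : Type u} [Quandle X] {G : Type v} [Group G] (f : X → G)
    (hf : ∀ x y, f (x ⊲ y) = (f y)⁻¹ * f x * f y) : As X →* G :=
  PresentedGroup.toGroup (f := f) (by
    rintro r ⟨x, y, rfl⟩
    simp [hf, mul_assoc])

@[simp]
theorem As.lift_e {X : Type u} [Quandle X] {G : Type v} [Group G] (f : X → G)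
    (hf : ∀ x y, f (x ⊲ y) = (f y)⁻¹ * f x * f y) (x : X) : As.lift f hf (e x) = f x :=
  PresentedGroup.toGroup.of _

/-- The homomorphism `f_* : As(X) → As(Y)`, `e_x ↦ e_{f x}`, induced by a quandle homomorphism. -/
def As.map {X : Type u} {Y : Type v} [Quandle X] [Quandle Y] (f : ShelfHom X Y) : As X →* As Y :=
  As.lift (fun x => e (f x)) (fun x y => by
    have h : f (x ⊲ y) = f x ⊲ f y := f.map_act'
    rw [h, e_rop])

/-- The homomorphism `ε : As(X) → ℤ` sending every generator `e_x` to `1`. -/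
def eps (X : Type u) [Quandle X] : As X →* Multiplicative ℤ :=
  As.lift (fun _ => Multiplicative.ofAdd 1) (fun _ _ => by simp)

/-- The right action of `As(X)` on `X`, as a homomorphism to the opposite of the group of
permutations: `e_y` acts by `x ↦ x ⊲ y`. -/
def actHom (X : Type u) [Quandle X] : As X →* (Equiv.Perm X)ᵐᵒᵖ :=
  As.lift (fun y => MulOpposite.op (Rack.act' y)) (fun x y => by
    change MulOpposite.op (Rack.act' (Shelf.act y x)) = _
    rw [Rack.ad_conj]
    simp [mul_assoc])

/-- `x · g` for `x ∈ X` and `g ∈ As(X)`. -/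
def ract {X : Type u} [Quandle X] (x : X) (g : As X) : X := (actHom X g).unop x

theorem ract_e {X : Type u} [Quandle X] (x y : X) : ract x (e y) = x ⊲ y := by
  simp [ract, actHom, rop]

theorem ract_one {X : Type u} [Quandle X] (x : X) : ract x 1 = x := by
  simp [ract]

theorem ract_mul {X : Type u} [Quandle X] (x : X) (g h : As X) :
    ract x (g * h) = ract (ract x g) h := by
  simp [ract]

/-- `e_{x · g} = g⁻¹ e_x g`. -/
theorem e_ract {X : Type u} [Quandle X] (g : As X) (x : X) : e (ract x g) = g⁻¹ * e x * g := by
  have hg : g ∈ Subgroup.closure (Set.range (PresentedGroup.of (rels := asRels X))) := by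
    rw [PresentedGroup.closure_range_of]; trivial
  induction hg using Subgroup.closure_induction generalizing x with
  | mem g hg =>
    obtain ⟨y, rfl⟩ := hg
    exact (congrArg e (ract_e x y)).trans (e_rop x y)
  | one => simp [ract_one]
  | mul g h _ _ ihg ihh => rw [ract_mul, ihh, ihg]; group
  | inv g _ ih =>
    have h := ih (ract x g⁻¹)
    rw [← ract_mul, inv_mul_cancel, ract_one] at h
    rw [h]; group

/-- A quandle is connected if the action of `As(X)` has exactly one orbit. -/
def IsConnected (X : Type u) [Quandle X] : Prop :=
  Nonempty X ∧ ∀ x y : X, ∃ g : As X, ract x g = y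

/-- `X` is of (finite) type `t`: `t` is the minimal `N > 0` such that `x ⊲^N y = x` for all
`x, y ∈ X`, where `• ⊲^N y` is the `N`-fold application of `• ⊲ y`. -/
def IsType (X : Type u) [Quandle X] (t : ℕ) : Prop :=
  IsLeast {N : ℕ | 0 < N ∧ ∀ x y : X, (fun z => z ⊲ y)^[N] x = x} t

/-! ### The universal covering -/

/-- The underlying set `Ker ε` of the universal covering of `X` based at `a`. -/
def Cover (X : Type u) [Quandle X] (_a : X) : Type u := (eps X).ker

namespace Cover

variable {X : Type u} [Quandle X] {a : X}

theorem eps_e (x : X) : eps X (e x) = Multiplicative.ofAdd 1 := As.lift_e _ _ _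

theorem eps_coe (g : Cover X a) : eps X g.1 = 1 := g.2

@[ext]
theorem ext {g h : Cover X a} (H : g.1 = h.1) : g = h := Subtype.ext H

/-- The quandle structure `g ⊲ h = e_a⁻¹ g h⁻¹ e_a h` on `Ker ε`. -/
instance : Quandle (Cover X a) where
  act h g := ⟨(e a)⁻¹ * g.1 * h.1⁻¹ * e a * h.1, by
    simp [MonoidHom.mem_ker, eps_coe]⟩
  invAct h g := ⟨e a * g.1 * h.1⁻¹ * (e a)⁻¹ * h.1, by
    simp [MonoidHom.mem_ker, eps_coe]⟩
  self_distrib {x y z} := by ext; simp only; group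
  left_inv x y := by ext; simp only; group
  right_inv x y := by ext; simp only; group
  fix {x} := by ext; simp only; group

theorem coe_rop (g h : Cover X a) : (g ⊲ h).1 = (e a)⁻¹ * g.1 * h.1⁻¹ * e a * h.1 := rfl

/-- The universal covering `p : X̃ → X`, `g ↦ a · g`. -/
def proj (a : X) : ShelfHom (Cover X a) X where
  toFun g := ract a g.1
  map_act' {h g} := by
    change ract a ((e a)⁻¹ * g.1 * h.1⁻¹ * e a * h.1) = ract a g.1 ⊲ ract a h.1
    have h1 : ract a (e a)⁻¹ = a := by
      have := ract_mul a (e a) (e a)⁻¹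
      rw [mul_inv_cancel, ract_one, ract_e, rop_self] at this
      exact this.symm
    rw [← ract_e (ract a g.1), e_ract, ← ract_mul, mul_assoc, mul_assoc, mul_assoc, ract_mul, h1]
    simp only [mul_assoc]

end Cover

/-! ### Quandle homology -/

/-- `C_n^R(X)`, the free `ℤ`-module on `X^n`. -/
abbrev RackChain (X : Type u) (n : ℕ) : Type u := (Fin n → X) →₀ ℤ

/-- The tuple `(x_1, …, x_{i-1}, x_{i+1}, …, x_{n+1})`. -/
def face0 {X : Type u} {n : ℕ} (i : Fin (n + 1)) (x : Fin (n + 1) → X) : Fin n → X :=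
  fun j => x (i.succAbove j)

/-- The tuple `(x_1 ⊲ x_i, …, x_{i-1} ⊲ x_i, x_{i+1}, …, x_{n+1})`. -/
def face1 {X : Type u} [Quandle X] {n : ℕ} (i : Fin (n + 1)) (x : Fin (n + 1) → X) : Fin n → X :=
  fun j => if (j : ℕ) < (i : ℕ) then x (i.succAbove j) ⊲ x i else x (i.succAbove j)

/-- The boundary `∂ : C_{n+1}^R(X) → C_n^R(X)`. The sign of the `i`-th term, counted from `0`,
is `(-1)^(i+1)`. -/
noncomputable def rackBoundary (X : Type u) [Quandle X] (n : ℕ) :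
    RackChain X (n + 1) →ₗ[ℤ] RackChain X n :=
  Finsupp.linearCombination ℤ fun x : Fin (n + 1) → X =>
    ∑ i : Fin (n + 1), (-1 : ℤ) ^ ((i : ℕ) + 1) •
      (Finsupp.single (face1 i x) (1 : ℤ) - Finsupp.single (face0 i x) (1 : ℤ))

/-- The tuple `x` has two equal consecutive entries. -/
def IsDegenerate {X : Type u} {n : ℕ} (x : Fin n → X) : Prop :=
  ∃ i j : Fin n, (i : ℕ) + 1 = (j : ℕ) ∧ x i = x j

/-- `C_n^D(X)`, the submodule of `C_n^R(X)` generated by the degenerate tuples. -/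
noncomputable def degenerateChain (X : Type u) (n : ℕ) : Submodule ℤ (RackChain X n) :=
  Submodule.span ℤ {c | ∃ x : Fin n → X, IsDegenerate x ∧ c = Finsupp.single x 1}

theorem single_mem_degenerateChain {X : Type u} {n : ℕ} {x : Fin n → X} (hx : IsDegenerate x) :
    Finsupp.single x (1 : ℤ) ∈ degenerateChain X n :=
  Submodule.subset_span ⟨x, hx, rfl⟩

theorem rackBoundary_single {X : Type u} [Quandle X] {n : ℕ} (x : Fin (n + 1) → X) :
    rackBoundary X n (Finsupp.single x 1) =
      ∑ i : Fin (n + 1), (-1 : ℤ) ^ ((i : ℕ) + 1) •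
        (Finsupp.single (face1 i x) (1 : ℤ) - Finsupp.single (face0 i x) (1 : ℤ)) := by
  simp [rackBoundary]

theorem succAbove_of_lt {n : ℕ} {i : Fin (n + 1)} {j : Fin n} (h : (j : ℕ) < (i : ℕ)) :
    i.succAbove j = j.castSucc := Fin.succAbove_of_castSucc_lt _ _ h

theorem succAbove_of_not_lt {n : ℕ} {i : Fin (n + 1)} {j : Fin n} (h : ¬ (j : ℕ) < (i : ℕ)) :
    i.succAbove j = j.succ := Fin.succAbove_of_le_castSucc _ _ (not_lt.mp h)

/-- The degenerate chains form a subcomplex. -/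
theorem degenerateChain_le_comap (X : Type u) [Quandle X] (n : ℕ) :
    degenerateChain X (n + 1) ≤ (degenerateChain X n).comap (rackBoundary X n) := by
  rw [degenerateChain, Submodule.span_le]
  rintro _ ⟨x, ⟨k, l, hkl, hx⟩, rfl⟩
  change rackBoundary X n (Finsupp.single x 1) ∈ degenerateChain X n
  rw [rackBoundary_single, ← Submodule.Quotient.mk_eq_zero, ← Submodule.mkQ_apply, map_sum]
  have hne : k ≠ l := fun h => by subst h; omega
  rw [Finset.sum_eq_add k l hne ?_ (by simp) (by simp)]
  · have h0 : face0 k x = face0 l x := by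
      funext j
      by_cases h1 : (j : ℕ) < k
      · have h2 : (j : ℕ) < l := by omega
        simp [face0, succAbove_of_lt h1, succAbove_of_lt h2]
      · by_cases h2 : (j : ℕ) < l
        · have h3 : j.succ = l := Fin.ext (by simp; omega)
          have h4 : j.castSucc = k := Fin.ext (by simp; omega)
          simp [face0, succAbove_of_not_lt h1, succAbove_of_lt h2, h3, h4, hx]
        · simp [face0, succAbove_of_not_lt h1, succAbove_of_not_lt h2]
    have h1 : face1 k x = face1 l x := by
      funext j
      by_cases h1 : (j : ℕ) < k
      · have h2 : (j : ℕ) < l := by omega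
        simp [face1, h1, h2, succAbove_of_lt h1, succAbove_of_lt h2, hx]
      · by_cases h2 : (j : ℕ) < l
        · have h3 : j.succ = l := Fin.ext (by simp; omega)
          have h4 : j.castSucc = k := Fin.ext (by simp; omega)
          simp [face1, h1, h2, succAbove_of_not_lt h1, succAbove_of_lt h2, h3, h4, hx, rop_self]
        · simp [face1, h1, h2, succAbove_of_not_lt h1, succAbove_of_not_lt h2]
    rw [h0, h1, ← hkl, pow_succ _ ((k : ℕ) + 1), ← map_add]
    simp
  · rintro i - ⟨hik, hil⟩
    have hik' : (i : ℕ) ≠ k := fun h => hik (Fin.ext h)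
    have hil' : (i : ℕ) ≠ l := fun h => hil (Fin.ext h)
    rw [Submodule.mkQ_apply, Submodule.Quotient.mk_eq_zero]
    refine Submodule.smul_mem _ _ (Submodule.sub_mem _ ?_ ?_) <;>
      refine single_mem_degenerateChain ?_
    all_goals
      by_cases h : (k : ℕ) < i
      · have hl : (l : ℕ) < i := by omega
        refine ⟨⟨k, by omega⟩, ⟨l, by omega⟩, hkl, ?_⟩
        have e1 : i.succAbove ⟨k, by omega⟩ = k := succAbove_of_lt (i := i) (j := ⟨k, by omega⟩) h
        have e2 : i.succAbove ⟨l, by omega⟩ = l := succAbove_of_lt (i := i) (j := ⟨l, by omega⟩) hl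
        simp [face0, face1, e1, e2, h, hl, hx]
      · have hl : (i : ℕ) < l := by omega
        refine ⟨⟨k - 1, by omega⟩, ⟨l - 1, by omega⟩, by simp; omega, ?_⟩
        have n1 : ¬ (k : ℕ) - 1 < i := by omega
        have n2 : ¬ (l : ℕ) - 1 < i := by omega
        have e1 : i.succAbove ⟨k - 1, by omega⟩ = k :=
          (succAbove_of_not_lt (i := i) (j := ⟨k - 1, by omega⟩) n1).trans
            (Fin.ext (by simp; omega))
        have e2 : i.succAbove ⟨l - 1, by omega⟩ = l :=
          (succAbove_of_not_lt (i := i) (j := ⟨l - 1, by omega⟩) n2).trans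
            (Fin.ext (by simp; omega))
        simp [face0, face1, e1, e2, n1, n2, hx]

/-- The chain group `C_n^R(X) / C_n^D(X)` of the quandle complex. -/
abbrev QuandleChain (X : Type u) (n : ℕ) : Type u := RackChain X n ⧸ degenerateChain X n

/-- The boundary of the quandle complex. -/
noncomputable def quandleBoundary (X : Type u) [Quandle X] (n : ℕ) :
    QuandleChain X (n + 1) →ₗ[ℤ] QuandleChain X n :=
  (degenerateChain X (n + 1)).mapQ (degenerateChain X n) (rackBoundary X n)
    (degenerateChain_le_comap X n)

/-- The cycles in degree `n`; every chain of degree `0` is a cycle. -/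
noncomputable def quandleCycles (X : Type u) [Quandle X] : (n : ℕ) → Submodule ℤ (QuandleChain X n)
  | 0 => ⊤
  | n + 1 => LinearMap.ker (quandleBoundary X n)

/-- The boundaries in degree `n`. -/
noncomputable def quandleBoundaries (X : Type u) [Quandle X] (n : ℕ) :
    Submodule ℤ (QuandleChain X n) :=
  LinearMap.range (quandleBoundary X n)

/-- The quandle homology `H_n^Q(X)`: cycles modulo boundaries. -/
abbrev QuandleHomology (X : Type u) [Quandle X] (n : ℕ) : Type u :=
  quandleCycles X n ⧸ (quandleBoundaries X n).submoduleOf (quandleCycles X n)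

end NosakaQuandle

/-!
A word in the generators of `As(Y)` is a path in `Y`, its letter `e_y` being an edge `x → x ⊲ y`.
Summing the classes of the pairs `(x, y)` along paths gives the universal quandle `2`-cocycle, with
values in `C₂ / B₂`. In a connected quandle, closing a path up at a base point `b` by chosen
elements of `Ker ε` gives a second cocycle, with values in the abelianized stabilizer of `b` in
`Ker ε`, and comparing the two gives Eisermann's isomorphism of `H₂^Q(Y)` with this
abelianization.

An element `G` of `As(X̃)` acts on `X̃` by `g ↦ e_a ^ (-ε(G)) g p_*(G)`. Hence `X̃` is connected
and the stabilizer in `Ker ε` of any point is `Ker p_*`, which acts trivially and so is central. If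
`X` is connected of type `t`, then `e_x ^ t` is central in `As(X)` and does not depend on `x`, so
`x ⊲^t y = x` also holds in `X̃`, and `e_g ^ t` does not depend on `g ∈ X̃`. The kernel of `p_*` is
generated by the central elements `e_g⁻¹ e_h` with `p(g) = p(h)`, whose `t`-th powers are trivial.
-/

namespace NosakaQuandle

/-! ### Adjoint groups and stabilizers -/

section AdjointGroup

variable {Y : Type*} [Quandle Y]

theorem As.closure_range_e : Subgroup.closure (Set.range (e : Y → As Y)) = ⊤ :=
  PresentedGroup.closure_range_of _

@[elab_as_elim]
theorem As.induction {p : As Y → Prop} (gen : ∀ y, p (e y)) (one : p 1)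
    (mul : ∀ g h, p g → p h → p (g * h)) (inv : ∀ g, p g → p g⁻¹) (g : As Y) : p g := by
  have hg : g ∈ Subgroup.closure (Set.range (e : Y → As Y)) := by
    rw [As.closure_range_e]
    exact Subgroup.mem_top g
  induction hg using Subgroup.closure_induction with
  | mem g hg => obtain ⟨y, rfl⟩ := hg; exact gen y
  | one => exact one
  | mul g h _ _ hg hh => exact mul g h hg hh
  | inv g _ hg => exact inv g hg

theorem As.hom_ext {G : Type*} [Group G] {φ ψ : As Y →* G} (h : ∀ y, φ (e y) = ψ (e y)) :
    φ = ψ :=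
  PresentedGroup.ext h

theorem e_mul_e_rop (x y : Y) : e y * e (x ⊲ y) = e x * e y := by
  rw [e_rop, mul_assoc, mul_inv_cancel_left]

theorem ract_e_self (y : Y) : ract y (e y) = y := by rw [ract_e, rop_self]

theorem ract_ract_inv (y : Y) (g : As Y) : ract (ract y g) g⁻¹ = y := by
  rw [← ract_mul, mul_inv_cancel, ract_one]

theorem ract_inv_ract (y : Y) (g : As Y) : ract (ract y g⁻¹) g = y := by
  rw [← ract_mul, inv_mul_cancel, ract_one]

theorem ract_e_pow (x y : Y) (n : ℕ) : ract x (e y ^ n) = (fun z => z ⊲ y)^[n] x := by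
  induction n with
  | zero => rw [pow_zero, ract_one, Function.iterate_zero_apply]
  | succ n ih => rw [pow_succ, ract_mul, ih, ract_e, Function.iterate_succ_apply']

/-- The stabilizer of `y` under the action of `As(Y)`. -/
def stabilizer (y : Y) : Subgroup (As Y) :=
  (MulAction.stabilizer (Equiv.Perm Y) y).op.comap (actHom Y)

theorem mem_stabilizer {y : Y} {g : As Y} : g ∈ stabilizer y ↔ ract y g = y := Iff.rfl

theorem e_mem_stabilizer (y : Y) : e y ∈ stabilizer y := ract_e_self y

theorem ract_e_zpow_self (y : Y) (n : ℤ) : ract y (e y ^ n) = y :=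
  zpow_mem (e_mem_stabilizer y) n

theorem commute_e_of_mem_stabilizer {y : Y} {g : As Y} (hg : g ∈ stabilizer y) :
    Commute (e y) g := by
  have h := e_ract g y
  rw [mem_stabilizer.mp hg, mul_assoc, eq_inv_mul_iff_mul_eq] at h
  exact h.symm

theorem mem_center_of_forall_mem_stabilizer {g : As Y} (h : ∀ y, g ∈ stabilizer y) :
    g ∈ Subgroup.center (As Y) := by
  rw [← Subgroup.centralizer_univ, ← Subgroup.coe_top, ← As.closure_range_e,
    Subgroup.centralizer_closure, Subgroup.mem_centralizer_iff]
  rintro _ ⟨y, rfl⟩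
  exact commute_e_of_mem_stabilizer (h y)

/-- The stabilizer of `y` under the action of `Ker(ε)`; it plays the role of the fundamental group
of `Y` based at `y`. -/
def kerStabilizer (y : Y) : Subgroup (As Y) := stabilizer y ⊓ (eps Y).ker

theorem mem_kerStabilizer {y : Y} {g : As Y} :
    g ∈ kerStabilizer y ↔ ract y g = y ∧ eps Y g = 1 := Iff.rfl

theorem IsConnected.exists_ract_eq (hY : IsConnected Y) (x y : Y) :
    ∃ g : As Y, ract x g = y ∧ eps Y g = 1 := by
  obtain ⟨g, hg⟩ := hY.2 x y
  refine ⟨e x ^ (-(eps Y g).toAdd) * g, by rw [ract_mul, ract_e_zpow_self, hg], ?_⟩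
  rw [map_mul, map_zpow, Cover.eps_e, ← ofAdd_zsmul]
  simp

theorem e_pow_mem_center {t : ℕ} (ht : ∀ x y : Y, (fun z => z ⊲ y)^[t] x = x) (y : Y) :
    e y ^ t ∈ Subgroup.center (As Y) :=
  mem_center_of_forall_mem_stabilizer fun x => (ract_e_pow x y t).trans (ht x y)

theorem IsConnected.e_pow_eq (hY : IsConnected Y) {t : ℕ}
    (ht : ∀ x y : Y, (fun z => z ⊲ y)^[t] x = x) (x y : Y) : e x ^ t = e y ^ t := by
  obtain ⟨g, rfl⟩ := hY.2 x y
  have hx := Subgroup.mem_center_iff.mp (e_pow_mem_center ht x) g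
  calc e x ^ t = g⁻¹ * e x ^ t * g := by rw [mul_assoc, ← hx, inv_mul_cancel_left]
    _ = (g⁻¹ * e x * g) ^ t := by simpa using (conj_pow (i := t) (a := g⁻¹) (b := e x)).symm
    _ = e (ract x g) ^ t := by rw [e_ract]

end AdjointGroup

section InducedMap

variable {X Y : Type*} [Quandle X] [Quandle Y] {f : ShelfHom Y X}

@[simp]
theorem As.map_e (y : Y) : As.map f (e y) = e (f y) := As.lift_e _ _ _

theorem map_rop (x y : Y) : f (x ⊲ y) = f x ⊲ f y := f.map_act'

theorem As.map_surjective (hf : Function.Surjective f) : Function.Surjective (As.map f) := by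
  rw [← MonoidHom.range_eq_top, eq_top_iff, ← As.closure_range_e, Subgroup.closure_le]
  rintro _ ⟨x, rfl⟩
  obtain ⟨y, rfl⟩ := hf x
  exact ⟨e y, As.map_e y⟩

theorem As.ker_map_le (hf : Function.Surjective f) {N : Subgroup (As Y)} [N.Normal]
    (hN : ∀ y z, f y = f z → (e y)⁻¹ * e z ∈ N) : (As.map f).ker ≤ N := by
  let π := QuotientGroup.mk' N
  let s := Function.surjInv hf
  have hs : ∀ x, f (s x) = x := Function.surjInv_eq hf
  have hπ : ∀ y z, f y = f z → π (e y) = π (e z) := fun y z h => QuotientGroup.eq.mpr (hN y z h)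
  let r : As X →* As Y ⧸ N := As.lift (fun x => π (e (s x))) fun x y => by
    rw [← map_inv, ← map_mul, ← map_mul, ← e_rop]
    exact hπ _ _ (by rw [map_rop, hs, hs, hs])
  have hr : r.comp (As.map f) = π := As.hom_ext fun y => by
    rw [MonoidHom.comp_apply, As.map_e, As.lift_e]
    exact hπ _ _ (hs _)
  intro k hk
  rw [← QuotientGroup.ker_mk' N, MonoidHom.mem_ker]
  calc π k = r (As.map f k) := DFunLike.congr_fun hr.symm k
    _ = 1 := by rw [MonoidHom.mem_ker.mp hk, map_one]

open scoped IsMulCommutative in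
theorem As.pow_eq_one_of_mem_ker_map (hY : IsConnected Y) {t : ℕ}
    (ht : ∀ x y : Y, (fun z => z ⊲ y)^[t] x = x) (hf : Function.Surjective f)
    (hc : (As.map f).ker ≤ Subgroup.center (As Y)) {k : As Y} (hk : k ∈ (As.map f).ker) :
    k ^ t = 1 := by
  let N : Subgroup (As Y) :=
    (powMonoidHom t : Subgroup.center (As Y) →* Subgroup.center (As Y)).ker.map
      (Subgroup.center (As Y)).subtype
  have hN_center : N ≤ Subgroup.center (As Y) := Subgroup.map_subtype_le _
  have hN_normal : N.Normal :=
    ⟨fun n hn g => by rwa [Subgroup.mem_center_iff.mp (hN_center hn) g, mul_inv_cancel_right]⟩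
  have hN : ∀ y z, f y = f z → (e y)⁻¹ * e z ∈ N := fun y z hyz => by
    have hyz_center : (e y)⁻¹ * e z ∈ Subgroup.center (As Y) :=
      hc (by rw [MonoidHom.mem_ker, map_mul, map_inv, As.map_e, As.map_e, hyz, inv_mul_cancel])
    refine ⟨⟨_, hyz_center⟩, Subtype.ext ?_, rfl⟩
    have h : Commute (e y) ((e y)⁻¹ * e z) := Subgroup.mem_center_iff.mp hyz_center (e y)
    have h_pow := h.mul_pow t
    rw [mul_inv_cancel_left, hY.e_pow_eq ht z y, left_eq_mul] at h_pow
    exact h_pow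
  obtain ⟨n, hn, rfl⟩ := As.ker_map_le hf hN hk
  exact congrArg Subtype.val hn

end InducedMap

/-! ### Quandle chains in low degrees -/

section Chains

variable {Y : Type*} {A : Type*} [AddCommGroup A]

/-- The class of a tuple in the quandle complex. -/
noncomputable def chain {n : ℕ} (v : Fin n → Y) : QuandleChain Y n :=
  (degenerateChain Y n).mkQ (Finsupp.single v 1)

theorem chain_eq_zero {n : ℕ} {v : Fin n → Y} (hv : IsDegenerate v) : chain v = 0 :=
  (Submodule.Quotient.mk_eq_zero _).mpr (single_mem_degenerateChain hv)

theorem QuandleChain.hom_ext {n : ℕ} {f g : QuandleChain Y n →ₗ[ℤ] A}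
    (h : ∀ v, f (chain v) = g (chain v)) : f = g :=
  Submodule.linearMap_qext _ (Finsupp.lhom_ext' fun v => LinearMap.ext_ring (h v))

/-- The linear map on quandle chains with prescribed values on tuples. -/
noncomputable def QuandleChain.lift {n : ℕ} (f : (Fin n → Y) → A)
    (hf : ∀ v, IsDegenerate v → f v = 0) : QuandleChain Y n →ₗ[ℤ] A :=
  (degenerateChain Y n).liftQ (Finsupp.linearCombination ℤ f) (by
    rw [degenerateChain, Submodule.span_le]
    rintro _ ⟨v, hv, rfl⟩
    simp [hf v hv])

@[simp]
theorem QuandleChain.lift_chain {n : ℕ} (f : (Fin n → Y) → A)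
    (hf : ∀ v, IsDegenerate v → f v = 0) (v : Fin n → Y) :
    QuandleChain.lift f hf (chain v) = f v := by
  simp [QuandleChain.lift, chain]

theorem not_isDegenerate_of_fin_one (v : Fin 1 → Y) : ¬ IsDegenerate v := by
  rintro ⟨i, j, hij, -⟩
  omega

theorem IsDegenerate.eq_of_fin_two {v : Fin 2 → Y} (h : IsDegenerate v) : v 0 = v 1 := by
  obtain ⟨i, j, hij, h⟩ := h
  obtain rfl : i = 0 := by omega
  obtain rfl : j = 1 := by omega
  exact h

variable [Quandle Y]

theorem quandleBoundary_chain {n : ℕ} (v : Fin (n + 1) → Y) :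
    quandleBoundary Y n (chain v) =
      ∑ i : Fin (n + 1), (-1 : ℤ) ^ ((i : ℕ) + 1) • (chain (face1 i v) - chain (face0 i v)) := by
  rw [chain, quandleBoundary, Submodule.mkQ_apply, Submodule.mapQ_apply, rackBoundary_single,
    ← Submodule.mkQ_apply, map_sum]
  simp only [map_smul, map_sub, chain]

theorem quandleBoundary_chain_two (x y : Y) :
    quandleBoundary Y 1 (chain ![x, y]) = chain ![x ⊲ y] - chain ![x] := by
  have h00 : face0 0 ![x, y] = ![y] := by ext j; fin_cases j; rfl
  have h10 : face1 0 ![x, y] = ![y] := by ext j; fin_cases j; rfl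
  have h01 : face0 1 ![x, y] = ![x] := by ext j; fin_cases j; rfl
  have h11 : face1 1 ![x, y] = ![x ⊲ y] := by ext j; fin_cases j; rfl
  rw [quandleBoundary_chain, Fin.sum_univ_two, h00, h10, h01, h11]
  simp

theorem quandleBoundary_chain_three (x y z : Y) :
    quandleBoundary Y 2 (chain ![x, y, z]) =
      (chain ![x, y] + chain ![x ⊲ y, z]) - (chain ![x, z] + chain ![x ⊲ z, y ⊲ z]) := by
  have h00 : face0 0 ![x, y, z] = ![y, z] := by ext j; fin_cases j <;> rfl
  have h10 : face1 0 ![x, y, z] = ![y, z] := by ext j; fin_cases j <;> rfl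
  have h01 : face0 1 ![x, y, z] = ![x, z] := by ext j; fin_cases j <;> rfl
  have h11 : face1 1 ![x, y, z] = ![x ⊲ y, z] := by ext j; fin_cases j <;> rfl
  have h02 : face0 2 ![x, y, z] = ![x, y] := by ext j; fin_cases j <;> rfl
  have h12 : face1 2 ![x, y, z] = ![x ⊲ z, y ⊲ z] := by ext j; fin_cases j <;> rfl
  rw [quandleBoundary_chain, Fin.sum_univ_three, h00, h10, h01, h11, h02, h12]
  simp only [Fin.coe_ofNat_eq_mod, Nat.reduceMod, Nat.reduceAdd, Int.reduceNeg, Int.reducePow,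
    sub_self, smul_zero, one_smul, neg_smul]
  abel

variable (Y) in
/-- The quotient `C_n / B_n` of the quandle chains by the boundaries. -/
abbrev ChainsModBoundaries (n : ℕ) : Type _ := QuandleChain Y n ⧸ quandleBoundaries Y n

variable (Y) in
/-- The inclusion of `H_n^Q(Y)` into `C_n / B_n`. -/
noncomputable def homologyInclusion (n : ℕ) : QuandleHomology Y n →ₗ[ℤ] ChainsModBoundaries Y n :=
  ((quandleBoundaries Y n).submoduleOf (quandleCycles Y n)).mapQ (quandleBoundaries Y n)
    (quandleCycles Y n).subtype (Submodule.submoduleOf.eq_1 _ _).le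

theorem homologyInclusion_injective (n : ℕ) : Function.Injective (homologyInclusion Y n) := by
  rw [← LinearMap.ker_eq_bot, homologyInclusion, Submodule.ker_mapQ, ← Submodule.submoduleOf,
    Submodule.mkQ_map_self]

/-- The class of the pair `(x, y)` in `C₂ / B₂`. -/
noncomputable def pair (x y : Y) : ChainsModBoundaries Y 2 :=
  (quandleBoundaries Y 2).mkQ (chain ![x, y])

theorem pair_self (x : Y) : pair x x = 0 := by
  rw [pair, chain_eq_zero ⟨0, 1, rfl, rfl⟩, map_zero]

theorem pair_cocycle (x y z : Y) :
    pair x y + pair (x ⊲ y) z = pair x z + pair (x ⊲ z) (y ⊲ z) := by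
  rw [← sub_eq_zero]
  simp only [pair, ← map_add, ← map_sub]
  rw [← quandleBoundary_chain_three, Submodule.mkQ_apply, Submodule.Quotient.mk_eq_zero]
  exact LinearMap.mem_range_self _ _

theorem ChainsModBoundaries.hom_ext {f g : ChainsModBoundaries Y 2 →ₗ[ℤ] A}
    (h : ∀ x y, f (pair x y) = g (pair x y)) : f = g := by
  refine Submodule.linearMap_qext _ (QuandleChain.hom_ext fun v => ?_)
  rw [show v = ![v 0, v 1] from List.ofFn_inj.mp rfl]
  exact h _ _

end Chains

/-! ### Quandle cocycles and sums along paths -/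

/-- A quandle `2`-cocycle `φ : Y × Y → A`, encoded by its sums along paths: `F g y` is the sum of
`φ` along the path that starts at `y` and is spelled by `g ∈ As(Y)`, so that `φ(x, y) = F (e y) x`.
The cocycle condition for `φ` is the compatibility of these sums with `e_y e_z = e_z e_{y ⊲ z}`. -/
structure QuandleCocycle (Y : Type*) [Quandle Y] (A : Type*) [AddCommGroup A] where
  toFun : As Y → Y → A
  map_mul' : ∀ g h y, toFun (g * h) y = toFun g y + toFun h (ract y g)
  map_e_self' : ∀ y, toFun (e y) y = 0

namespace QuandleCocycle

variable {Y : Type*} [Quandle Y] {A B : Type*} [AddCommGroup A] [AddCommGroup B]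

instance : CoeFun (QuandleCocycle Y A) fun _ => As Y → Y → A := ⟨toFun⟩

theorem apply_mul (F : QuandleCocycle Y A) (g h : As Y) (y : Y) :
    F (g * h) y = F g y + F h (ract y g) :=
  F.map_mul' g h y

theorem apply_e_self (F : QuandleCocycle Y A) (y : Y) : F (e y) y = 0 := F.map_e_self' y

theorem apply_one (F : QuandleCocycle Y A) (y : Y) : F 1 y = 0 := by
  simpa [ract_one] using F.apply_mul 1 1 y

theorem apply_inv (F : QuandleCocycle Y A) (g : As Y) (y : Y) : F g⁻¹ y = -F g (ract y g⁻¹) := by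
  rw [eq_neg_iff_add_eq_zero, ← apply_mul, inv_mul_cancel, apply_one]

variable (Y A) in
/-- The left action of `As(Y)` on the functions `Y → A` that is induced by its right action
on `Y`. -/
def funAut : As Y →* MulAut (Y → Multiplicative A) where
  toFun g :=
    { toFun f y := f (ract y g)
      invFun f y := f (ract y g⁻¹)
      left_inv f := by simp only [ract_inv_ract]
      right_inv f := by simp only [ract_ract_inv]
      map_mul' _ _ := rfl }
  map_one' := by ext; simp [ract_one]
  map_mul' g h := by ext; simp [ract_mul]

/-- The section of `(Y → A) ⋊ As(Y) → As(Y)` that corresponds to a cocycle. -/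
def toSection (F : QuandleCocycle Y A) : As Y →* (Y → Multiplicative A) ⋊[funAut Y A] As Y :=
  MonoidHom.mk' (fun g => ⟨fun y => .ofAdd (F g y), g⟩) fun g h => by
    ext y
    · exact F.apply_mul g h y
    · rfl

theorem eq_of_forall_e {F F' : QuandleCocycle Y A} (h : ∀ x y, F (e y) x = F' (e y) x)
    (g : As Y) (y : Y) : F g y = F' g y := by
  have h_section : F.toSection = F'.toSection := As.hom_ext fun z =>
    SemidirectProduct.ext (funext fun x => h x z) rfl
  exact congrFun (congrArg SemidirectProduct.left (DFunLike.congr_fun h_section g)) y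

/-- The image of a cocycle under a homomorphism of coefficients. -/
def mapCoeff (f : A →+ B) (F : QuandleCocycle Y A) : QuandleCocycle Y B where
  toFun g y := f (F g y)
  map_mul' g h y := by rw [F.apply_mul, map_add]
  map_e_self' y := by rw [F.apply_e_self, map_zero]

/-- The coboundary of a function on `Y`. -/
def coboundary (f : Y → A) : QuandleCocycle Y A where
  toFun g y := f (ract y g) - f y
  map_mul' g h y := by rw [ract_mul]; abel
  map_e_self' y := by rw [ract_e_self, sub_self]

theorem cocycle_condition (F : QuandleCocycle Y A) (x y z : Y) :
    F (e y) x + F (e z) (x ⊲ y) = F (e z) x + F (e (y ⊲ z)) (x ⊲ z) := by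
  rw [← ract_e, ← ract_e x z, ← F.apply_mul, ← F.apply_mul, e_mul_e_rop]

/-- The linear map `C₂ / B₂ → A` defined by a cocycle. -/
noncomputable def lift (F : QuandleCocycle Y A) : ChainsModBoundaries Y 2 →ₗ[ℤ] A :=
  (quandleBoundaries Y 2).liftQ
    (QuandleChain.lift (fun v => F (e (v 1)) (v 0)) fun v hv => by
      rw [hv.eq_of_fin_two, F.apply_e_self]) (by
    rw [quandleBoundaries, LinearMap.range_le_ker_iff]
    refine QuandleChain.hom_ext fun v => ?_
    rw [show v = ![v 0, v 1, v 2] from List.ofFn_inj.mp rfl, LinearMap.comp_apply,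
      quandleBoundary_chain_three]
    simpa [sub_eq_zero] using F.cocycle_condition (v 0) (v 1) (v 2))

@[simp]
theorem lift_pair (F : QuandleCocycle Y A) (x y : Y) : F.lift (pair x y) = F (e y) x := by
  simp [lift, pair]

variable (Y) in
/-- The section of `(Y → C₂ / B₂) ⋊ As(Y) → As(Y)` that sends `e_y` to `x ↦ [(x, y)]`. -/
noncomputable def pairSection :
    As Y →* (Y → Multiplicative (ChainsModBoundaries Y 2)) ⋊[funAut Y _] As Y :=
  As.lift (fun y => ⟨fun x => .ofAdd (pair x y), e y⟩) fun x y => by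
    rw [mul_assoc, eq_inv_mul_iff_mul_eq]
    refine SemidirectProduct.ext (funext fun w => ?_) (e_mul_e_rop x y)
    change pair w y + pair (ract w (e y)) (x ⊲ y) = pair w x + pair (ract w (e x)) y
    rw [ract_e, ract_e, pair_cocycle w x y]

theorem pairSection_right (g : As Y) : (pairSection Y g).right = g := by
  have h : SemidirectProduct.rightHom.comp (pairSection Y) = MonoidHom.id (As Y) :=
    As.hom_ext fun y => by simp [pairSection]
  exact DFunLike.congr_fun h g

theorem pairSection_e (x y : Y) : ((pairSection Y (e y)).left x).toAdd = pair x y := by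
  simp [pairSection]

variable (Y) in
/-- The universal cocycle, which sums the classes of the pairs `(x, y)` along paths. -/
noncomputable def pathSum : QuandleCocycle Y (ChainsModBoundaries Y 2) where
  toFun g y := ((pairSection Y g).left y).toAdd
  map_mul' g h y := by
    rw [map_mul, SemidirectProduct.mul_left, pairSection_right]
    rfl
  map_e_self' y := by rw [pairSection_e, pair_self]

theorem pathSum_e (x y : Y) : pathSum Y (e y) x = pair x y := pairSection_e x y

theorem lift_pathSum (F : QuandleCocycle Y A) (g : As Y) (y : Y) :
    F.lift (pathSum Y g y) = F g y :=
  eq_of_forall_e (F := (pathSum Y).mapCoeff F.lift.toAddMonoidHom) (F' := F)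
    (fun x z => (congrArg F.lift (pathSum_e x z)).trans (F.lift_pair x z)) g y

/-- The restriction of a cocycle to the loops at `b`. -/
def stabilizerHom (F : QuandleCocycle Y A) (b : Y) : stabilizer b →* Multiplicative A :=
  MonoidHom.mk' (fun g => .ofAdd (F g b)) fun g h => by
    rw [Subgroup.coe_mul, F.apply_mul, mem_stabilizer.mp g.2, ofAdd_add]

theorem apply_e_zpow_self (F : QuandleCocycle Y A) (b : Y) (n : ℤ) : F (e b ^ n) b = 0 := by
  have h := map_zpow (F.stabilizerHom b) ⟨e b, e_mem_stabilizer b⟩ n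
  rwa [show F.stabilizerHom b ⟨e b, e_mem_stabilizer b⟩ = 1 from F.apply_e_self b, one_zpow] at h

/-- The homomorphism on the abelianized stabilizer of `b` in `Ker(ε)` given by the sums of a
cocycle along loops. -/
def periods (F : QuandleCocycle Y A) (b : Y) :
    Additive (Abelianization (kerStabilizer b)) →+ A :=
  (Abelianization.lift
    ((F.stabilizerHom b).comp (Subgroup.inclusion inf_le_left))).toAdditiveLeft

theorem periods_of (F : QuandleCocycle Y A) (b : Y) (k : kerStabilizer b) :
    F.periods b (.ofMul (.of k)) = F k b := rfl

end QuandleCocycle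

open QuandleCocycle

section Boundary

variable {Y : Type*} [Quandle Y]

variable (Y) in
/-- The boundary `C₂ / B₂ → C₁`. -/
noncomputable def boundaryMod : ChainsModBoundaries Y 2 →ₗ[ℤ] QuandleChain Y 1 :=
  (coboundary fun y => chain ![y]).lift

theorem boundaryMod_pathSum (g : As Y) (y : Y) :
    boundaryMod Y (pathSum Y g y) = chain ![ract y g] - chain ![y] :=
  lift_pathSum _ g y

theorem boundaryMod_mkQ (c : QuandleChain Y 2) :
    boundaryMod Y ((quandleBoundaries Y 2).mkQ c) = quandleBoundary Y 1 c := by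
  have h : boundaryMod Y ∘ₗ (quandleBoundaries Y 2).mkQ = quandleBoundary Y 1 := by
    refine QuandleChain.hom_ext fun v => ?_
    rw [show v = ![v 0, v 1] from List.ofFn_inj.mp rfl, quandleBoundary_chain_two, ← ract_e]
    exact lift_pair _ _ _
  exact LinearMap.congr_fun h c

theorem range_homologyInclusion_two :
    LinearMap.range (homologyInclusion Y 2) = LinearMap.ker (boundaryMod Y) := by
  rw [homologyInclusion, Submodule.range_mapQ, Submodule.range_subtype]
  ext q
  obtain ⟨c, rfl⟩ := (quandleBoundaries Y 2).mkQ_surjective q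
  constructor
  · rintro ⟨z, hz, h⟩
    rw [← h, LinearMap.mem_ker, boundaryMod_mkQ]
    exact hz
  · intro h
    rw [LinearMap.mem_ker, boundaryMod_mkQ] at h
    exact ⟨c, h, rfl⟩

end Boundary

/-! ### The second homology of a connected quandle -/

/-- A choice, for each `y ∈ Y`, of an element of `Ker(ε)` that carries the base point `b`
to `y`. -/
structure PathSystem {Y : Type*} [Quandle Y] (b : Y) where
  path : Y → As Y
  ract_path : ∀ y, ract b (path y) = y
  eps_path : ∀ y, eps Y (path y) = 1

namespace PathSystem

variable {Y : Type*} [Quandle Y] {b : Y} (S : PathSystem b)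

theorem ract_path_inv (y : Y) : ract y (S.path y)⁻¹ = b := by
  simpa only [S.ract_path] using ract_ract_inv b (S.path y)

/-- The path from `y` spelled by `g`, closed up at `b`; the power of `e_b` moves the loop
into `Ker(ε)`. -/
def loop (g : As Y) (y : Y) : kerStabilizer b :=
  ⟨e b ^ (-(eps Y g).toAdd) * S.path y * g * (S.path (ract y g))⁻¹, by
    refine mem_kerStabilizer.mpr ⟨?_, ?_⟩
    · rw [ract_mul, ract_mul, ract_mul, ract_e_zpow_self, S.ract_path, S.ract_path_inv]
    · simp [S.eps_path, Cover.eps_e, ← ofAdd_zsmul]⟩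

theorem loop_mul (g h : As Y) (y : Y) : S.loop (g * h) y = S.loop g y * S.loop h (ract y g) := by
  have h_comm : Commute (e b ^ (-(eps Y h).toAdd)) (S.loop g y : As Y) :=
    (commute_e_of_mem_stabilizer (S.loop g y).2.1).zpow_left _
  ext
  calc (S.loop (g * h) y : As Y)
      = e b ^ (-(eps Y h).toAdd) * S.loop g y * S.path (ract y g) * h *
          (S.path (ract (ract y g) h))⁻¹ := by
        simp only [loop, map_mul, toAdd_mul, ract_mul, neg_add_rev, zpow_add]; group
    _ = S.loop g y * S.loop h (ract y g) := by
        rw [h_comm.eq]; simp only [loop, mul_assoc]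

theorem loop_e_self (y : Y) : S.loop (e y) y = 1 := by
  have h : e b = S.path y * e y * (S.path y)⁻¹ := by
    simpa only [S.ract_path_inv, inv_inv] using e_ract (S.path y)⁻¹ y
  ext
  simp only [loop, ract_e_self, Cover.eps_e, toAdd_ofAdd, zpow_neg_one, h, OneMemClass.coe_one]
  group

theorem exists_loop_base_eq_conj (k : kerStabilizer b) :
    ∃ s : kerStabilizer b, S.loop k b = s * k * s⁻¹ := by
  refine ⟨⟨S.path b, S.ract_path b, S.eps_path b⟩, ?_⟩
  ext
  simp [loop, (mem_kerStabilizer.mp k.2).1, (mem_kerStabilizer.mp k.2).2, mul_assoc]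

/-- The cocycle given by the classes of the loops in the abelianized stabilizer. -/
def loopCocycle : QuandleCocycle Y (Additive (Abelianization (kerStabilizer b))) where
  toFun g y := .ofMul (.of (S.loop g y))
  map_mul' g h y := by rw [loop_mul, map_mul, ofMul_mul]
  map_e_self' y := by rw [loop_e_self, map_one, ofMul_one]

theorem lift_loopCocycle_periods (k : Additive (Abelianization (kerStabilizer b))) :
    S.loopCocycle.lift ((pathSum Y).periods b k) = k := by
  obtain ⟨k, rfl⟩ := QuotientGroup.mk_surjective k
  obtain ⟨s, hs⟩ := S.exists_loop_base_eq_conj k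
  calc S.loopCocycle.lift ((pathSum Y).periods b (.ofMul (.of k)))
      = S.loopCocycle.lift (pathSum Y k b) := by rw [periods_of]
    _ = .ofMul (.of (S.loop k b)) := lift_pathSum _ _ _
    _ = .ofMul (.of k) := by
      congr 1
      rw [hs, map_mul, map_mul, map_inv, mul_right_comm, mul_inv_cancel, one_mul]

/-- The linear map that sends a `1`-chain to the sums along the chosen paths to its points. -/
noncomputable def pathChain : QuandleChain Y 1 →ₗ[ℤ] ChainsModBoundaries Y 2 :=
  QuandleChain.lift (fun v => pathSum Y (S.path (v 0)) b)
    fun v hv => (not_isDegenerate_of_fin_one v hv).elim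

theorem pathChain_chain (y : Y) : S.pathChain (chain ![y]) = pathSum Y (S.path y) b :=
  QuandleChain.lift_chain _ _ _

theorem pathSum_loop (g : As Y) (y : Y) :
    pathSum Y (S.loop g y) b =
      pathSum Y (S.path y) b + pathSum Y g y - pathSum Y (S.path (ract y g)) b := by
  simp only [loop, apply_mul, apply_inv, apply_e_zpow_self, ract_mul, ract_e_zpow_self,
    S.ract_path, S.ract_path_inv]
  abel

theorem periods_lift_loopCocycle (c : ChainsModBoundaries Y 2) :
    (pathSum Y).periods b (S.loopCocycle.lift c) = c - S.pathChain (boundaryMod Y c) := by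
  have h : ((pathSum Y).periods b).toIntLinearMap ∘ₗ S.loopCocycle.lift =
      LinearMap.id - S.pathChain ∘ₗ boundaryMod Y := ChainsModBoundaries.hom_ext fun x y => by
    calc (pathSum Y).periods b (S.loopCocycle.lift (pair x y))
        = pathSum Y (S.loop (e y) x) b := by
          rw [lift_pair]
          exact periods_of _ _ _
      _ = pair x y - S.pathChain (boundaryMod Y (pair x y)) := by
        rw [pathSum_loop, ← pathSum_e, boundaryMod_pathSum, map_sub, pathChain_chain,
          pathChain_chain]
        abel
  exact LinearMap.congr_fun h c

/-- The homomorphism that sends a cycle to the class of the corresponding product of loops. -/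
noncomputable def homologyHom :
    QuandleHomology Y 2 →ₗ[ℤ] Additive (Abelianization (kerStabilizer b)) :=
  S.loopCocycle.lift ∘ₗ homologyInclusion Y 2

theorem homologyHom_bijective : Function.Bijective S.homologyHom := by
  constructor
  · rw [injective_iff_map_eq_zero]
    intro c hc
    have h_cycle : boundaryMod Y (homologyInclusion Y 2 c) = 0 :=
      range_homologyInclusion_two.le (LinearMap.mem_range_self _ c)
    have h := S.periods_lift_loopCocycle (homologyInclusion Y 2 c)
    rw [h_cycle, map_zero, sub_zero, show S.loopCocycle.lift (homologyInclusion Y 2 c) = 0 from hc,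
      map_zero] at h
    exact homologyInclusion_injective 2 (h.symm.trans (map_zero _).symm)
  · intro k
    have h_cycle : boundaryMod Y ((pathSum Y).periods b k) = 0 := by
      obtain ⟨k, rfl⟩ := QuotientGroup.mk_surjective k
      calc boundaryMod Y ((pathSum Y).periods b (.ofMul (.of k)))
          = chain ![ract b k] - chain ![b] := by rw [periods_of, boundaryMod_pathSum]
        _ = 0 := by rw [(mem_kerStabilizer.mp k.2).1, sub_self]
    obtain ⟨c, hc⟩ := range_homologyInclusion_two.ge h_cycle
    exact ⟨c, (congrArg S.loopCocycle.lift hc).trans (S.lift_loopCocycle_periods k)⟩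

end PathSystem

/-- **Eisermann's theorem**: the second quandle homology of a connected quandle is the
abelianization of the stabilizer of a point in `Ker(ε)`. -/
noncomputable def IsConnected.homologyEquiv {Y : Type*} [Quandle Y] (hY : IsConnected Y) (b : Y) :
    Multiplicative (QuandleHomology Y 2) ≃* Abelianization (kerStabilizer b) :=
  let S : PathSystem b :=
    { path := fun y => (hY.exists_ract_eq b y).choose
      ract_path := fun y => (hY.exists_ract_eq b y).choose_spec.1
      eps_path := fun y => (hY.exists_ract_eq b y).choose_spec.2 }
  AddEquiv.toMultiplicativeLeft (AddEquiv.ofBijective S.homologyHom S.homologyHom_bijective)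

/-! ### The universal covering -/

namespace Cover

variable {X : Type*} [Quandle X] {a : X}

theorem map_proj_e (g : Cover X a) : As.map (proj a) (e g) = g.1⁻¹ * e a * g.1 :=
  (As.map_e g).trans (e_ract g.1 a)

theorem eps_map_proj (G : As (Cover X a)) : eps X (As.map (proj a) G) = eps (Cover X a) G := by
  have h : (eps X).comp (As.map (proj a)) = eps (Cover X a) := As.hom_ext fun g => by
    simp [eps_e]
  exact DFunLike.congr_fun h G

theorem ract_coe (g : Cover X a) (G : As (Cover X a)) :
    e a ^ (eps _ G).toAdd * (ract g G).1 = g.1 * As.map (proj a) G := by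
  induction G using As.induction generalizing g with
  | gen h =>
    rw [ract_e, coe_rop, map_proj_e, eps_e]
    simp [mul_assoc]
  | one => simp [ract_one]
  | mul G H hG hH =>
    rw [ract_mul, (eps _).map_mul, (As.map (proj a)).map_mul, toAdd_mul, zpow_add, mul_assoc, hH,
      ← mul_assoc, hG, mul_assoc]
  | inv G hG =>
    have h := hG (ract g G⁻¹)
    rw [ract_inv_ract] at h
    rw [(eps _).map_inv, (As.map (proj a)).map_inv, toAdd_inv, zpow_neg,
      inv_mul_eq_iff_eq_mul, ← mul_assoc, h, mul_inv_cancel_right]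

theorem ract_coe_of_eps_eq_one (g : Cover X a) {G : As (Cover X a)} (hG : eps _ G = 1) :
    (ract g G).1 = g.1 * As.map (proj a) G := by
  simpa [hG] using ract_coe g G

theorem proj_surjective (hX : IsConnected X) : Function.Surjective (proj a) := fun x =>
  let ⟨g, hg, hε⟩ := hX.exists_ract_eq a x
  ⟨⟨g, hε⟩, hg⟩

theorem isConnected (hX : IsConnected X) : IsConnected (Cover X a) := by
  refine ⟨⟨⟨1, one_mem _⟩⟩, fun g h => ?_⟩
  obtain ⟨G, hG⟩ := As.map_surjective (proj_surjective (a := a) hX) (g.1⁻¹ * h.1)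
  have hε : eps _ G = 1 := by
    rw [← eps_map_proj, hG, map_mul, map_inv, eps_coe, eps_coe, inv_one, one_mul]
  exact ⟨G, ext (by rw [ract_coe_of_eps_eq_one g hε, hG, mul_inv_cancel_left])⟩

theorem kerStabilizer_eq_ker_map_proj (g : Cover X a) :
    kerStabilizer g = (As.map (proj a)).ker := by
  ext G
  rw [mem_kerStabilizer, MonoidHom.mem_ker]
  constructor
  · rintro ⟨h_fix, hε⟩
    have h := ract_coe_of_eps_eq_one g hε
    rwa [h_fix, left_eq_mul] at h
  · intro h
    have hε : eps _ G = 1 := by rw [← eps_map_proj, h, map_one]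
    exact ⟨ext (by rw [ract_coe_of_eps_eq_one g hε, h, mul_one]), hε⟩

theorem ker_map_proj_le_center : (As.map (proj a)).ker ≤ Subgroup.center (As (Cover X a)) :=
  fun _ hG => mem_center_of_forall_mem_stabilizer fun g =>
    ((kerStabilizer_eq_ker_map_proj g).ge hG).1

theorem iterate_rop (hX : IsConnected X) {t : ℕ}
    (ht : ∀ x y : X, (fun z => z ⊲ y)^[t] x = x) (g h : Cover X a) :
    (fun z => z ⊲ h)^[t] g = g := by
  have h_act : e a ^ t * (ract g (e h ^ t)).1 = g.1 * e (proj a h) ^ t := by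
    simpa [eps_e, ← ofAdd_nsmul] using ract_coe g (e h ^ t)
  rw [hX.e_pow_eq ht (proj a h) a] at h_act
  rw [← ract_e_pow]
  have h_comm := Subgroup.mem_center_iff.mp (e_pow_mem_center ht a) g.1
  exact ext (mul_left_cancel (h_act.trans h_comm))

open scoped IsMulCommutative in
/-- The isomorphism between `H₂^Q(X̃)` and the kernel of `p_*`. -/
noncomputable def homologyEquiv (hX : IsConnected X) (a : X) :
    Multiplicative (QuandleHomology (Cover X a) 2) ≃* (As.map (proj a)).ker :=
  let b : Cover X a := ⟨1, one_mem _⟩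
  have : IsMulCommutative (As.map (proj a)).ker :=
    ⟨⟨fun G H => Subtype.ext (Subgroup.mem_center_iff.mp (ker_map_proj_le_center H.2) G)⟩⟩
  ((isConnected hX).homologyEquiv b).trans <|
    (MulEquiv.subgroupCongr (kerStabilizer_eq_ker_map_proj b)).abelianizationCongr.trans
      Abelianization.equivOfComm.symm

theorem pow_eq_one_of_mem_ker_map_proj (hX : IsConnected X) {t : ℕ}
    (ht : ∀ x y : X, (fun z => z ⊲ y)^[t] x = x) (k : (As.map (proj a)).ker) : k ^ t = 1 :=
  Subtype.ext <| As.pow_eq_one_of_mem_ker_map (isConnected hX) (iterate_rop hX ht)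
    (proj_surjective hX) ker_map_proj_le_center k.2

end Cover

end NosakaQuandle

theorem theorem5p4 {X : Type*} [Quandle X] (hX : NosakaQuandle.IsConnected X) (a : X) :
    Nonempty
      (Multiplicative (NosakaQuandle.QuandleHomology (NosakaQuandle.Cover X a) 2) ≃*
        (NosakaQuandle.As.map (NosakaQuandle.Cover.proj a)).ker) ∧
    ∀ t : ℕ, NosakaQuandle.IsType X t →
      ∀ c : NosakaQuandle.QuandleHomology (NosakaQuandle.Cover X a) 2, t • c = 0 := by
  refine ⟨⟨NosakaQuandle.Cover.homologyEquiv hX a⟩, fun t ht c => ?_⟩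
  let E := NosakaQuandle.Cover.homologyEquiv hX a
  have h_pow : E (Multiplicative.ofAdd c ^ t) = 1 := by
    rw [map_pow, NosakaQuandle.Cover.pow_eq_one_of_mem_ker_map_proj hX ht.1.2]
  exact Multiplicative.ofAdd.injective ((map_eq_one_iff E E.injective).mp h_pow)
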